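/- Let $\mathfrak A$ be a unital $C^*$-algebra with unit $\mathbb 1$ and let $\mathfrak k\subsetneq\mathfrak A$ be a proper closed two-sided ideal. Let $G=\mathfrak A^\times$ (a real Banach--Lie group with Lie algebra $\mathfrak A$, $[v,w]=vw-wv$) and $K=\mathfrak A^\times\cap(\mathbb 1+\mathfrak k)$. The homogeneous space $G/K$ is a Banach manifold modelled on $\mathfrak A/\mathfrak k$ through the open embedding $gK\mapsto g+\mathfrak k$ into $\mathfrak A/\mathfrak k$; let $\pi:G\to G/K$ be the projection, $p_0=\pi(\mathbb 1)$, and $\alpha_g(hK)=ghK$. A bounded real-linear operator $N$ on $\mathfrak A$ is called admissible if $N\mathfrak k\subset\mathfrak k$ and $gN(a)g^{-1}-N(gag^{-1})\in\mathfrak k$ for all $g\in K$, $a\in\mathfrak A$. It induces the bundle map $\mathcal N$ of $T(G/K)$ covering the identity if $\mathcal N_{p_0}\pi_{*\mathbb 1}v=\pi_{*\mathbb 1}Nv$ for all $v\in\mathfrak A$ and $\mathcal N_{\alpha_g(p_0)}=(\alpha_g)_*\mathcal N_{p_0}(\alpha_g)_*^{-1}$ for all $g\in G$. A smooth bundle map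 $\mathcal N$ is Nijenhuis if $\mathcal N[\mathcal NX,Y]+\mathcal N[X,\mathcal NY]-[\mathcal NX,\mathcal NY]-\mathcal N^2[X,Y]=0$ for all smooth vector fields $X,Y$ on $G/K$; it is an almost complex structure if $\mathcal N^2=-1$. There is a bounded complex-linear functional $\ell:\mathfrak A\to\mathbb C$ with $\ell|_{\mathfrak k}=0$ and $\ell(\mathbb 1)=1$ (a Hahn--Banach extension of the functional on $\mathbb C\mathbb 1+\mathfrak k$ with these values). For every such $\ell$ and every $n\in\mathfrak A\setminus\mathfrak k$, put $N(a)=\ell(a)\,n$. Then: 1. $N$ is admissible, and it induces exactly one bundle map $\mathcal N$ on $T(G/K)$; this $\mathcal N$ is smooth and homogeneous, i.e. $(\alpha_g)_*\mathcal N_p=\mathcal N_{\alpha_g(p)}(\alpha_g)_*$ for all $g\in G$, $p\in G/K$. 2. For every $p\in G/K$ the kernel of $\mathcal N_p$ is a complex subspace of $T_p(G/K)\cong\mathfrak A/\mathfrak k$ of complex codimension $1$. If $\mathfrak A\neq\mathbb C\mathbb 1+\mathfrak k$, then no $\mathcal N_p$ is invertible and $\mathcal N$ is not an almost complex structure. 3.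 If $\ell(n)\neq0$, then $\mathcal N$ is Nijenhuis if and only if $\ell([v,w])=0$ for all $v,w\in\mathfrak A$. 4. If $\ell(n)=0$, then $\mathcal N$ is Nijenhuis if and only if $\ell([v,n])=0$ for all $v\in\mathfrak A$. -/

import Mathlib

open scoped Manifold ContDiff

noncomputable section

namespace RankOne

/-! ### Bundle maps and the Nijenhuis torsion on a Banach manifold -/

section Manifold

variable {E : Type*} [NormedAddCommGroup E] [NormedSpace ℝ E]
  (M : Type*) [TopologicalSpace M] [ChartedSpace E M]

/-- A fibrewise bounded linear map of the tangent bundle of the real Banach manifold `M`,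
covering the identity. Smoothness is the separate predicate `IsSmoothBundleMap`. -/
abbrev BundleMap : Type _ :=
  ∀ p : M, TangentSpace 𝓘(ℝ, E) p →L[ℝ] TangentSpace 𝓘(ℝ, E) p

variable {M}

/-- `𝒩` is smooth as a map `TM → TM`. -/
def IsSmoothBundleMap [IsManifold 𝓘(ℝ, E) 1 M] (𝒩 : BundleMap (E := E) M) : Prop :=
  ContMDiff (𝓘(ℝ, E)).tangent (𝓘(ℝ, E)).tangent ∞
    (fun x : TangentBundle 𝓘(ℝ, E) M => (⟨x.1, 𝒩 x.1 x.2⟩ : TangentBundle 𝓘(ℝ, E) M))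

/-- `X` is a smooth vector field on `M`. -/
def IsSmoothVectorField [IsManifold 𝓘(ℝ, E) 1 M]
    (X : ∀ p : M, TangentSpace 𝓘(ℝ, E) p) : Prop :=
  ContMDiff 𝓘(ℝ, E) (𝓘(ℝ, E)).tangent ∞
    (fun p : M => (⟨p, X p⟩ : TangentBundle 𝓘(ℝ, E) M))

/-- The Nijenhuis torsion `𝒩[𝒩X,Y] + 𝒩[X,𝒩Y] - [𝒩X,𝒩Y] - 𝒩²[X,Y]`. -/
def nijenhuisTorsion (𝒩 : BundleMap (E := E) M) (X Y : ∀ p : M, TangentSpace 𝓘(ℝ, E) p)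
    (p : M) : TangentSpace 𝓘(ℝ, E) p :=
  𝒩 p (VectorField.mlieBracket 𝓘(ℝ, E) (fun q => 𝒩 q (X q)) Y p)
    + 𝒩 p (VectorField.mlieBracket 𝓘(ℝ, E) X (fun q => 𝒩 q (Y q)) p)
    - VectorField.mlieBracket 𝓘(ℝ, E) (fun q => 𝒩 q (X q)) (fun q => 𝒩 q (Y q)) p
    - 𝒩 p (𝒩 p (VectorField.mlieBracket 𝓘(ℝ, E) X Y p))

/-- A Nijenhuis operator: a smooth bundle map whose torsion vanishes on all smooth vector
fields. -/
def IsNijenhuis [IsManifold 𝓘(ℝ, E) 1 M] (𝒩 : BundleMap (E := E) M) : Prop :=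
  IsSmoothBundleMap 𝒩 ∧ ∀ X Y : ∀ p : M, TangentSpace 𝓘(ℝ, E) p,
    IsSmoothVectorField X → IsSmoothVectorField Y → ∀ p : M, nijenhuisTorsion 𝒩 X Y p = 0

/-- An almost complex structure: a smooth bundle map with `𝒩² = -1`. -/
def IsAlmostComplex [IsManifold 𝓘(ℝ, E) 1 M] (𝒩 : BundleMap (E := E) M) : Prop :=
  IsSmoothBundleMap 𝒩 ∧ ∀ (p : M) (u : TangentSpace 𝓘(ℝ, E) p), 𝒩 p (𝒩 p u) = -u

end Manifold

/-! ### The homogeneous space of a closed ideal in a unital C⋆-algebra -/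

lemma isOpenMap_continuous_quotient {A : Type*} [CStarAlgebra A] (k : Ideal A) :
    IsOpenMap (fun a : A => (Submodule.Quotient.mk a : A ⧸ k)) ∧
      Continuous (fun a : A => (Submodule.Quotient.mk a : A ⧸ k)) :=
  ⟨(Submodule.isOpenQuotientMap_mkQ k).isOpenMap, continuous_quot_mk⟩

section Homogeneous

variable {A : Type*} [CStarAlgebra A] (k : Ideal A) [k.IsTwoSided]

/-- The subgroup `K = Aˣ ∩ (1 + k)` of `G = Aˣ`. -/
def K : Subgroup Aˣ where
  carrier := {g | (g : A) - 1 ∈ k}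
  one_mem' := by simp
  mul_mem' := by
    intro a b ha hb
    have h : ((a * b : Aˣ) : A) - 1 = ((a : A) - 1) * (b : A) + ((b : A) - 1) := by
      rw [Units.val_mul]; noncomm_ring
    show ((a * b : Aˣ) : A) - 1 ∈ k
    rw [h]
    exact k.add_mem (k.mul_mem_right _ ha) hb
  inv_mem' := by
    intro a ha
    have h : ((a⁻¹ : Aˣ) : A) - 1 = -(((a⁻¹ : Aˣ) : A) * ((a : A) - 1)) := by
      rw [mul_sub, Units.inv_mul]; noncomm_ring
    show ((a⁻¹ : Aˣ) : A) - 1 ∈ k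
    rw [h]
    exact k.neg_mem (k.mul_mem_left _ ha)

/-- The space `G/K`, with the quotient topology. -/
abbrev GK : Type _ := Aˣ ⧸ K k

/-- The projection `π : G → G/K`. -/
def proj (g : Aˣ) : GK k := QuotientGroup.mk g

/-- The base point `p₀ = π(1)`. -/
def basePoint : GK k := proj k 1

lemma proj_eq_iff (a b : Aˣ) : proj k a = proj k b ↔ (a : A) - b ∈ k := by
  unfold proj
  rw [QuotientGroup.eq]
  show ((a⁻¹ * b : Aˣ) : A) - 1 ∈ k ↔ _
  constructor
  · intro h
    have e : (a : A) - b = -((a : A) * (((a⁻¹ * b : Aˣ) : A) - 1)) := by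
      rw [mul_sub, ← Units.val_mul, mul_inv_cancel_left]; noncomm_ring
    rw [e]
    exact k.neg_mem (k.mul_mem_left _ h)
  · intro h
    have e : ((a⁻¹ * b : Aˣ) : A) - 1 = -(((a⁻¹ : Aˣ) : A) * ((a : A) - b)) := by
      rw [mul_sub, Units.inv_mul, Units.val_mul]; noncomm_ring
    rw [e]
    exact k.neg_mem (k.mul_mem_left _ h)

/-- The map `ι : G/K → A/k`, `π(a) ↦ a + k`. -/
def iota : GK k → A ⧸ k :=
  Quotient.lift (fun g : Aˣ => (Submodule.Quotient.mk (g : A) : A ⧸ k)) (by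
    intro a b h
    rw [Submodule.Quotient.eq]
    exact (proj_eq_iff k a b).1 (Quotient.sound h))

@[simp] lemma iota_proj (g : Aˣ) : iota k (proj k g) = Submodule.Quotient.mk (g : A) := rfl

lemma iota_injective : Function.Injective (iota k) := by
  intro x y
  refine Quotient.inductionOn₂ x y fun a b h => ?_
  exact (proj_eq_iff k a b).2 ((Submodule.Quotient.eq k).1 h)

lemma iota_isOpenEmbedding : Topology.IsOpenEmbedding (iota k) := by
  refine .of_continuous_injective_isOpenMap ?_ (iota_injective k) ?_
  · refine continuous_quot_lift _ ?_
    exact (isOpenMap_continuous_quotient k).2.comp Units.continuous_val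
  · intro U hU
    have h1 : IsOpen ((proj k) ⁻¹' U) := hU.preimage continuous_quot_mk
    have h2 := (isOpenMap_continuous_quotient k).1 _ (Units.isOpenEmbedding_val.isOpenMap _ h1)
    convert h2 using 1
    ext y
    constructor
    · rintro ⟨x, hx, rfl⟩
      induction x using Quotient.inductionOn with
      | h a => exact ⟨a, ⟨a, hx, rfl⟩, rfl⟩
    · rintro ⟨_, ⟨a, ha, rfl⟩, rfl⟩
      exact ⟨proj k a, ha, rfl⟩

variable [IsClosed (k : Set A)]

/-- The Banach manifold structure of `G/K`, modelled on `A/k`: the global chart `ι` identifies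
`G/K` with an open subset of the Banach space `A/k`. -/
instance : ChartedSpace (A ⧸ k) (GK k) :=
  (iota_isOpenEmbedding k).singletonChartedSpace

instance (n : ℕ∞ω) : IsManifold 𝓘(ℝ, A ⧸ k) n (GK k) :=
  (iota_isOpenEmbedding k).isManifold_singleton

/-- The differential `π_{*1} : A → T_{p₀}(G/K)`. -/
def projDiff : TangentSpace 𝓘(ℝ, A) (1 : Aˣ) →L[ℝ] TangentSpace 𝓘(ℝ, A ⧸ k) (basePoint k) :=
  mfderiv 𝓘(ℝ, A) 𝓘(ℝ, A ⧸ k) (proj k) 1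

/-- The quotient map `a ↦ a + k` as a bounded real-linear map. -/
def quotientCLM : A →L[ℝ] A ⧸ k where
  toLinearMap := k.mkQ.restrictScalars ℝ
  cont := (isOpenMap_continuous_quotient k).2

instance : T2Space (GK k) := (iota_isOpenEmbedding k).isEmbedding.t2Space

/-- `π : G → G/K` is smooth. -/
lemma contMDiff_proj : ContMDiff 𝓘(ℝ, A) 𝓘(ℝ, A ⧸ k) ∞ (proj k) := by
  apply ContMDiff.of_comp_isOpenEmbedding (iota_isOpenEmbedding k)
  exact (quotientCLM k).contMDiff.comp Units.contMDiff_val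

/-- `π_{*1}` is the quotient map `A → A/k`; in particular it is surjective. -/
lemma projDiff_apply (v : A) : projDiff k v = (Submodule.Quotient.mk v : A ⧸ k) := by
  have h : projDiff k = (quotientCLM k : A →L[ℝ] A ⧸ k) := by
    have : writtenInExtChartAt 𝓘(ℝ, A) 𝓘(ℝ, A ⧸ k) (1 : Aˣ) (proj k) =ᶠ[nhds (1 : A)]
        quotientCLM k := by
      filter_upwards [Units.isOpenEmbedding_val.isOpen_range.mem_nhds ⟨(1 : Aˣ), rfl⟩]
      rintro _ ⟨g, rfl⟩
      have hg : (extChartAt 𝓘(ℝ, A) (1 : Aˣ)).symm (g : A) = g :=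
        (extChartAt 𝓘(ℝ, A) (1 : Aˣ)).left_inv (x := g) (by simp)
      show iota k (proj k ((extChartAt 𝓘(ℝ, A) (1 : Aˣ)).symm (g : A))) = _
      rw [hg]; rfl
    have hf := ((quotientCLM k).hasFDerivAt (x := (1 : A))).congr_of_eventuallyEq this
    have hm : HasMFDerivAt 𝓘(ℝ, A) 𝓘(ℝ, A ⧸ k) (proj k) 1 (quotientCLM k : A →L[ℝ] A ⧸ k) :=
      ⟨(contMDiff_proj k).continuous.continuousAt, hf.hasFDerivWithinAt⟩
    exact hm.mfderiv
  rw [h]; rfl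

/-- The differential `(α_g)_* : T_p(G/K) → T_{g·p}(G/K)` of the action `α_g : p ↦ g·p`. -/
def actDiff (g : Aˣ) (p : GK k) :
    TangentSpace 𝓘(ℝ, A ⧸ k) p →L[ℝ] TangentSpace 𝓘(ℝ, A ⧸ k) (g • p) :=
  mfderiv 𝓘(ℝ, A ⧸ k) 𝓘(ℝ, A ⧸ k) (fun q : GK k => g • q) p

/-- A homogeneous bundle map: smooth, and `(α_g)_* 𝒩_p = 𝒩_{g·p} (α_g)_*`. -/
def IsHomogeneous (𝒩 : BundleMap (E := A ⧸ k) (GK k)) : Prop :=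
  IsSmoothBundleMap 𝒩 ∧ ∀ (g : Aˣ) (p : GK k) (u : TangentSpace 𝓘(ℝ, A ⧸ k) p),
    actDiff k g p (𝒩 p u) = 𝒩 (g • p) (actDiff k g p u)

/-- Admissible operators: `N k ⊆ k` and `Ran (Ad_g N - N Ad_g) ⊆ k` for all `g ∈ K`,
where `Ad_g a = g a g⁻¹`. -/
structure IsAdmissible (N : A →L[ℝ] A) : Prop where
  map_mem : ∀ x ∈ k, N x ∈ k
  ad_comm : ∀ g ∈ K k, ∀ a : A,
    (g : A) * N a * ((g⁻¹ : Aˣ) : A) - N ((g : A) * a * ((g⁻¹ : Aˣ) : A)) ∈ k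

/-- `𝒩` is the bundle map induced by the operator `N` on the Lie algebra `A = T₁G`: at `p₀` it
is given by `𝒩_{p₀} (π_{*1} v) = π_{*1} (N v)`, and at `p = g·p₀` it is
`(α_g)_* 𝒩_{p₀} (α_g)_*⁻¹`. -/
structure IsInducedBy (N : A →L[ℝ] A) (𝒩 : BundleMap (E := A ⧸ k) (GK k)) : Prop where
  base : ∀ v : A, 𝒩 (basePoint k) (projDiff k v) = projDiff k (N v)
  translate : ∀ (g : Aˣ) (u : TangentSpace 𝓘(ℝ, A ⧸ k) (basePoint k)),
    𝒩 (g • basePoint k) (actDiff k g (basePoint k) u) =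
      actDiff k g (basePoint k) (𝒩 (basePoint k) u)

/-- A bounded extension to `A` of the functional on `ℂ1 + k` that is `0` on `k` and `1` at `1`. -/
structure IsHahnBanachExtension (ℓ : A →L[ℂ] ℂ) : Prop where
  map_ideal : ∀ x ∈ k, ℓ x = 0
  map_one : ℓ 1 = 1

end Homogeneous

/-- The rank one operator `N(a) = ℓ(a) n`, as a bounded real-linear operator. -/
def rankOne {A : Type*} [CStarAlgebra A] (ℓ : A →L[ℂ] ℂ) (n : A) : A →L[ℝ] A :=
  (ℓ.smulRight n).restrictScalars ℝ

end RankOne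

end

/-! Since `k` is a closed two-sided ideal, `B = A/k` is a normed algebra, `ι` identifies `G/K` with
an open set of units of `B`, and `G` acts there by left multiplication. The functional `ℓ` descends
to `L` on `B`. In this chart the two conditions on an induced map leave only `𝒩_b(u) = L(b⁻¹u) b n`
(`isInducedBy_rankOne_iff`), which is smooth and equivariant because inversion and multiplication
are. As `b n ≠ 0`, the kernel of `𝒩_b` is that of the nonzero functional `u ↦ L(b⁻¹u)`.

For `X_b = b x` and `Y_b = b y` the torsion at `b` is `(L(y) L[x,n] - L(x) L[y,n] - L(n) L[x,y]) b
n` (`translateRankOne_torsion`, `nijenhuisTorsion_rankOne`). So `𝒩` is Nijenhuis iff this scalar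
vanishes for all `x`, `y`. Taking `y = 1` gives `L[x,n] = 0`, and what remains is `L(n) L[x,y] = 0`;
the two cases for `ℓ(n)` follow. -/

namespace RankOne

/-! ### Rank one operators translated over the units of a normed algebra -/

section BanachAlgebra

variable {B : Type*} [NormedRing B] [NormedAlgebra ℂ B]

/-- The rank one operator `u ↦ ℓ(b⁻¹ u) b n`, the translate to `b` of `u ↦ ℓ(u) n`. -/
noncomputable def translateRankOne (ℓ : B →L[ℂ] ℂ) (n b : B) : B →L[ℝ] B :=
  ((ℓ.comp (ContinuousLinearMap.mul ℂ B (Ring.inverse b))).smulRight (b * n)).restrictScalars ℝ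

lemma translateRankOne_apply (ℓ : B →L[ℂ] ℂ) (n b u : B) :
    translateRankOne ℓ n b u = ℓ (Ring.inverse b * u) • (b * n) := rfl

/-- Holds because `(gb)⁻¹(gu) = b⁻¹u`. This equivariance under left multiplication gives both the
translation rule for the induced map and its homogeneity. -/
lemma translateRankOne_mul (ℓ : B →L[ℂ] ℂ) (n g b u : B) (hg : IsUnit g) (hb : IsUnit b) :
    translateRankOne ℓ n (g * b) (g * u) = g * translateRankOne ℓ n b u := by
  obtain ⟨g, rfl⟩ := hg
  obtain ⟨b, rfl⟩ := hb
  have h : Ring.inverse ((g : B) * b) * (g * u) = Ring.inverse (b : B) * u := by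
    rw [← Units.val_mul, Ring.inverse_unit, Ring.inverse_unit]
    simp [mul_assoc]
  rw [translateRankOne_apply, translateRankOne_apply, h, mul_smul_comm, mul_assoc]

/-- Product rule, with `v ↦ -b⁻¹ v b⁻¹` as the derivative of inversion at `b`. -/
lemma hasFDerivAt_translateRankOne_apply [HasSummableGeomSeries B] (ℓ : B →L[ℂ] ℂ) (n : B)
    (b : Bˣ) {X : B → B} (hX : DifferentiableAt ℝ X b) :
    ∃ F : B →L[ℝ] B, HasFDerivAt (fun c => translateRankOne ℓ n c (X c)) F (b : B) ∧
      ∀ v, F v = ℓ (↑b⁻¹ * fderiv ℝ X b v - ↑b⁻¹ * v * ↑b⁻¹ * X b) • (b * n)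
        + ℓ (↑b⁻¹ * X b) • (v * n) := by
  have h1 := (hasFDerivAt_ringInverse (𝕜 := ℝ) b).mul' hX.hasFDerivAt
  have h2 := (ℓ.restrictScalars ℝ).hasFDerivAt.comp (b : B) h1
  have h3 := h2.smul ((hasFDerivAt_id (𝕜 := ℝ) (b : B)).mul_const' n)
  refine ⟨_, h3, fun v => ?_⟩
  simp [sub_eq_add_neg, mul_assoc]
  abel

/-- The torsion is tensorial: when the four brackets are expanded, every term containing a
derivative of `X` or `Y` cancels, and only the derivatives of `b⁻¹` and `b n` contribute. -/
lemma translateRankOne_torsion [HasSummableGeomSeries B] (ℓ : B →L[ℂ] ℂ) (n : B) (b : Bˣ)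
    {X Y : B → B} (hX : DifferentiableAt ℝ X b) (hY : DifferentiableAt ℝ Y b) :
    translateRankOne ℓ n b
        (VectorField.lieBracket ℝ (fun c => translateRankOne ℓ n c (X c)) Y b)
      + translateRankOne ℓ n b
        (VectorField.lieBracket ℝ X (fun c => translateRankOne ℓ n c (Y c)) b)
      - VectorField.lieBracket ℝ (fun c => translateRankOne ℓ n c (X c))
        (fun c => translateRankOne ℓ n c (Y c)) b
      - translateRankOne ℓ n b (translateRankOne ℓ n b (VectorField.lieBracket ℝ X Y b))
    = (ℓ (↑b⁻¹ * Y b) * ℓ ⁅↑b⁻¹ * X b, n⁆ - ℓ (↑b⁻¹ * X b) * ℓ ⁅↑b⁻¹ * Y b, n⁆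
        - ℓ n * ℓ ⁅↑b⁻¹ * X b, ↑b⁻¹ * Y b⁆) • (b * n) := by
  obtain ⟨F, hF, hFv⟩ := hasFDerivAt_translateRankOne_apply ℓ n b hX
  obtain ⟨G, hG, hGv⟩ := hasFDerivAt_translateRankOne_apply ℓ n b hY
  have e (v : B) : translateRankOne ℓ n b v = ℓ (↑b⁻¹ * v) • (b * n) := by
    rw [translateRankOne_apply, Ring.inverse_unit]
  simp only [VectorField.lieBracket, hF.fderiv, hG.fderiv, hFv, hGv, e, Ring.lie_def]
  simp only [mul_sub, mul_add, map_sub, map_add, map_smul, mul_smul_comm,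
    smul_mul_assoc, smul_eq_mul, mul_assoc, Units.inv_mul_cancel_left, sub_smul, add_smul]
  match_scalars <;> ring

lemma contDiffAt_translateRankOne [HasSummableGeomSeries B] (ℓ : B →L[ℂ] ℂ) (n : B) (b : Bˣ)
    (u : B) :
    ContDiffAt ℝ ∞ (fun x : B × B => translateRankOne ℓ n x.1 x.2) ((b : B), u) := by
  have h1 : ContDiffAt ℝ ∞ (fun x : B × B => Ring.inverse x.1) ((b : B), u) :=
    (contDiffAt_ringInverse ℝ b).comp ((b : B), u) contDiffAt_fst
  exact ((ℓ.restrictScalars ℝ).contDiff.contDiffAt.comp ((b : B), u)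
    (h1.mul contDiffAt_snd)).smul (contDiffAt_fst.mul contDiffAt_const)

end BanachAlgebra


/-! ### Calculus on `G/K` in the global chart -/

lemma mlieBracket_vectorSpace_eq_lieBracket {E : Type*} [NormedAddCommGroup E] [NormedSpace ℝ E]
    (V W : ∀ x : E, TangentSpace 𝓘(ℝ, E) x) (x : E) :
    VectorField.mlieBracket 𝓘(ℝ, E) V W x = VectorField.lieBracket ℝ V W x := by
  rw [← VectorField.mlieBracketWithin_univ, VectorField.mlieBracketWithin_eq_lieBracketWithin]
  exact congrFun (VectorField.lieBracketWithin_univ (V := V) (W := W)) x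

section Chart

open Topology Filter

variable {A : Type*} [CStarAlgebra A] (k : Ideal A) [k.IsTwoSided]

/-- `Function.invFun (iota k)` serves as a chart inverse defined on all of `A/k` and independent of
a base point. Its arbitrary values off the open range of `ι` do not affect germs at points of the
range. -/
lemma invFun_iota (p : GK k) : Function.invFun (iota k) (iota k p) = p :=
  Function.leftInverse_invFun (iota_injective k) p

lemma range_iota_mem_nhds (p : GK k) : Set.range (iota k) ∈ 𝓝 (iota k p) :=
  (iota_isOpenEmbedding k).isOpen_range.mem_nhds ⟨p, rfl⟩

variable [IsClosed (k : Set A)]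

lemma extChartAt_symm_iota (p q : GK k) :
    (extChartAt 𝓘(ℝ, A ⧸ k) p).symm (iota k q) = q :=
  (extChartAt 𝓘(ℝ, A ⧸ k) p).left_inv (x := q) (by
    rw [extChartAt_source]
    exact Set.mem_univ q)

lemma extChartAt_symm_eventuallyEq (p : GK k) :
    (extChartAt 𝓘(ℝ, A ⧸ k) p).symm =ᶠ[𝓝 (iota k p)] Function.invFun (iota k) := by
  filter_upwards [range_iota_mem_nhds k p]
  rintro _ ⟨q, rfl⟩
  rw [extChartAt_symm_iota, invFun_iota]

lemma contMDiff_iota : ContMDiff 𝓘(ℝ, A ⧸ k) 𝓘(ℝ, A ⧸ k) ∞ (iota k) :=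
  contMDiff_isOpenEmbedding (iota_isOpenEmbedding k)

/-- A map `f` on `G/K` whose expression in the global chart is `F` near `p` has the same
derivative as `F`. -/
lemma hasMFDerivAt_of_iota {f : GK k → GK k} {F : A ⧸ k → A ⧸ k}
    (hf : ∀ q, iota k (f q) = F (iota k q))
    {p : GK k} {F' : (A ⧸ k) →L[ℝ] A ⧸ k} (hF : HasFDerivAt F F' (iota k p)) :
    HasMFDerivAt 𝓘(ℝ, A ⧸ k) 𝓘(ℝ, A ⧸ k) f p F' := by
  refine ⟨?_, ?_⟩
  · rw [(iota_isOpenEmbedding k).isInducing.continuousAt_iff]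
    have : iota k ∘ f = F ∘ iota k := funext hf
    rw [this]
    exact hF.continuousAt.comp (iota_isOpenEmbedding k).continuous.continuousAt
  · refine (hF.congr_of_eventuallyEq ?_).hasFDerivWithinAt
    filter_upwards [range_iota_mem_nhds k p]
    rintro _ ⟨q, rfl⟩
    rw [← hf q]
    show iota k (f ((extChartAt 𝓘(ℝ, A ⧸ k) p).symm (iota k q))) = _
    rw [extChartAt_symm_iota]

lemma mfderiv_iota (p : GK k) :
    mfderiv 𝓘(ℝ, A ⧸ k) 𝓘(ℝ, A ⧸ k) (iota k) p = ContinuousLinearMap.id ℝ (A ⧸ k) := by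
  refine HasMFDerivAt.mfderiv ⟨(iota_isOpenEmbedding k).continuous.continuousAt, ?_⟩
  refine ((hasFDerivAt_id (iota k p)).congr_of_eventuallyEq ?_).hasFDerivWithinAt
  filter_upwards [range_iota_mem_nhds k p]
  rintro _ ⟨q, rfl⟩
  show iota k ((extChartAt 𝓘(ℝ, A ⧸ k) p).symm (iota k q)) = _
  rw [extChartAt_symm_iota]; rfl

/-- The tangent bundle of `G/K` is trivialized by the global chart. -/
lemma trivializationAt_snd (p : GK k) (x : TangentBundle 𝓘(ℝ, A ⧸ k) (GK k)) :
    (trivializationAt (A ⧸ k) (TangentSpace 𝓘(ℝ, A ⧸ k)) p x).2 = x.2 :=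
  (tangentBundleCore 𝓘(ℝ, A ⧸ k) (GK k)).coordChange_self (achart (A ⧸ k) x.1) x.1
    (mem_achart_source (A ⧸ k) x.1) x.2

lemma isSmoothVectorField_iff (X : GK k → A ⧸ k) :
    IsSmoothVectorField (E := A ⧸ k) (M := GK k) X ↔ ContMDiff 𝓘(ℝ, A ⧸ k) 𝓘(ℝ, A ⧸ k) ∞ X := by
  refine forall_congr' fun p => ?_
  refine (Bundle.contMDiffAt_section p).trans ?_
  simp only [trivializationAt_snd]

lemma contMDiff_tangentBundle_snd :
    ContMDiff (M' := A ⧸ k) (𝓘(ℝ, A ⧸ k)).tangent 𝓘(ℝ, A ⧸ k) ∞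
      (fun x : TangentBundle 𝓘(ℝ, A ⧸ k) (GK k) => x.2) := fun x => by
  have h := (Bundle.contMDiffAt_totalSpace.1 (contMDiffAt_id
    (I := (𝓘(ℝ, A ⧸ k)).tangent) (n := ∞) (x := x))).2
  simpa only [trivializationAt_snd] using! h

/-- A bundle map is smooth as soon as it is given in the global chart by a smooth map. -/
lemma isSmoothBundleMap_of_contDiffAt {𝒩 : BundleMap (E := A ⧸ k) (GK k)}
    {θ : (A ⧸ k) × (A ⧸ k) → A ⧸ k}
    (hθ : ∀ p (u : A ⧸ k), ContDiffAt ℝ ∞ θ (iota k p, u))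
    (h𝒩 : ∀ p (u : A ⧸ k), 𝒩 p u = θ (iota k p, u)) : IsSmoothBundleMap 𝒩 := fun x => by
  refine Bundle.contMDiffAt_totalSpace.2 ⟨Bundle.contMDiffAt_proj _, ?_⟩
  simp only [trivializationAt_snd]
  have h1 : ContMDiffAt (𝓘(ℝ, A ⧸ k)).tangent 𝓘(ℝ, (A ⧸ k) × (A ⧸ k)) ∞
      (fun y : TangentBundle 𝓘(ℝ, A ⧸ k) (GK k) => ((iota k y.1, y.2) : (A ⧸ k) × (A ⧸ k))) x :=
    ((contMDiff_iota k).contMDiffAt.comp x (Bundle.contMDiffAt_proj _)).prodMk_space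
      (contMDiff_tangentBundle_snd k x)
  exact (ContMDiffAt.comp (g := θ)
    (f := fun y : TangentBundle 𝓘(ℝ, A ⧸ k) (GK k) => ((iota k y.1, y.2) : (A ⧸ k) × (A ⧸ k)))
    x (hθ x.1 x.2).contMDiffAt h1).congr_of_eventuallyEq (.of_forall fun y => h𝒩 y.1 y.2)

lemma contDiffAt_comp_invFun_iota {f : GK k → A ⧸ k} {p : GK k}
    (hf : ContMDiffAt 𝓘(ℝ, A ⧸ k) 𝓘(ℝ, A ⧸ k) ∞ f p) :
    ContDiffAt ℝ ∞ (fun b => f (Function.invFun (iota k) b)) (iota k p) := by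
  have h := (contMDiffAt_iff.1 hf).2
  rw [ModelWithCorners.range_eq_univ, contDiffWithinAt_univ] at h
  refine h.congr_of_eventuallyEq ?_
  filter_upwards [extChartAt_symm_eventuallyEq k p] with b hb
  show _ = f _
  rw [hb]

lemma mpullback_iota (Z : A ⧸ k → A ⧸ k) (q : GK k) :
    VectorField.mpullback 𝓘(ℝ, A ⧸ k) 𝓘(ℝ, A ⧸ k) (iota k) (M' := A ⧸ k) Z q = Z (iota k q) := by
  show (mfderiv 𝓘(ℝ, A ⧸ k) 𝓘(ℝ, A ⧸ k) (iota k) q).inverse (Z (iota k q)) = _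
  rw [mfderiv_iota]
  exact congrArg (fun T : (A ⧸ k) →L[ℝ] A ⧸ k => T (Z (iota k q))) ContinuousLinearMap.inverse_id

/-- The Lie bracket on `G/K` is computed in the global chart. -/
lemma mlieBracket_eq_lieBracket {X Y : GK k → A ⧸ k} {p : GK k}
    (hX : ContMDiffAt 𝓘(ℝ, A ⧸ k) 𝓘(ℝ, A ⧸ k) ∞ X p)
    (hY : ContMDiffAt 𝓘(ℝ, A ⧸ k) 𝓘(ℝ, A ⧸ k) ∞ Y p) :
    VectorField.mlieBracket 𝓘(ℝ, A ⧸ k) (M := GK k) X Y p =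
      VectorField.lieBracket ℝ (fun b => X (Function.invFun (iota k) b))
        (fun b => Y (Function.invFun (iota k) b)) (iota k p) := by
  -- Each field is the pullback along `ι` of its chart expression, so naturality of the bracket
  -- under pullback applies.
  have pull (Z : GK k → A ⧸ k) :
      VectorField.mpullback 𝓘(ℝ, A ⧸ k) 𝓘(ℝ, A ⧸ k) (iota k) (M' := A ⧸ k)
        (fun b => Z (Function.invFun (iota k) b)) = Z := by
    funext q
    rw [mpullback_iota, invFun_iota]
  have diff {Z : GK k → A ⧸ k} (hZ : ContMDiffAt 𝓘(ℝ, A ⧸ k) 𝓘(ℝ, A ⧸ k) ∞ Z p) :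
      MDifferentiableAt 𝓘(ℝ, A ⧸ k) (𝓘(ℝ, A ⧸ k)).tangent
        (fun b : A ⧸ k => (⟨b, Z (Function.invFun (iota k) b)⟩ :
          TangentBundle 𝓘(ℝ, A ⧸ k) (A ⧸ k))) (iota k p) :=
    (contMDiffAt_vectorSpace_iff_contDiffAt.2 (contDiffAt_comp_invFun_iota k hZ)).mdifferentiableAt
      (by simp)
  have hn : minSmoothness ℝ 2 ≤ (∞ : ℕ∞ω) := by
    rw [minSmoothness_of_isRCLikeNormedField]
    exact WithTop.coe_le_coe.2 le_top
  have h := VectorField.mpullback_mlieBracket (n := ∞) (diff hX) (diff hY) (contMDiff_iota k p) hn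
  rw [pull, pull] at h
  exact h.symm.trans ((mpullback_iota k _ p).trans (mlieBracket_vectorSpace_eq_lieBracket _ _ _))

end Chart


/-! ### The quotient algebra `A/k` and the induced map in the chart -/

section QuotientAlgebra

variable {A : Type*} [CStarAlgebra A] (k : Ideal A) [k.IsTwoSided]

lemma exists_quotientFunctional {ℓ : A →L[ℂ] ℂ} (hℓ : IsHahnBanachExtension k ℓ) :
    ∃ L : (A ⧸ k) →L[ℂ] ℂ, ∀ a, L (Ideal.Quotient.mk k a) = ℓ a := by
  -- `k` is an `A`-submodule while `ℓ` is only `ℂ`-linear, so the lift is made additively and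
  -- homogeneity is checked afterwards.
  let L₀ : (A ⧸ k) →+ ℂ := QuotientAddGroup.lift k.toAddSubgroup ℓ.toLinearMap.toAddMonoidHom
    hℓ.map_ideal
  have hL₀ (a : A) : L₀ (Ideal.Quotient.mk k a) = ℓ a := rfl
  refine ⟨⟨⟨L₀.toAddHom, fun c x => ?_⟩, ?_⟩, hL₀⟩
  · obtain ⟨a, rfl⟩ := Ideal.Quotient.mk_surjective x
    exact ℓ.map_smul c a
  · exact (Submodule.isOpenQuotientMap_mkQ k).isQuotientMap.continuous_iff.2 ℓ.continuous

/-- Elements of `K` are `1` modulo `k`, so `Ad_g` is trivial modulo `k`, and `ℓ` depends only on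
classes modulo `k`. -/
lemma isAdmissible_rankOne {ℓ : A →L[ℂ] ℂ} (hℓ : IsHahnBanachExtension k ℓ) (n : A) :
    IsAdmissible k (rankOne ℓ n) := by
  obtain ⟨L, hL⟩ := exists_quotientFunctional k hℓ
  have hN (a : A) : rankOne ℓ n a = ℓ a • n := rfl
  refine ⟨fun x hx => ?_, fun g hg a => ?_⟩
  · rw [hN, hℓ.map_ideal x hx, zero_smul]
    exact k.zero_mem
  · have h1 : (Ideal.Quotient.mk k (g : A) : A ⧸ k) = 1 := by
      rw [← map_one (Ideal.Quotient.mk k)]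
      exact Ideal.Quotient.eq.2 hg
    have h2 : (Ideal.Quotient.mk k ((g⁻¹ : Aˣ) : A) : A ⧸ k) = 1 := by
      rw [← map_one (Ideal.Quotient.mk k)]
      exact Ideal.Quotient.eq.2 ((K k).inv_mem hg)
    have h3 : ℓ ((g : A) * a * ((g⁻¹ : Aˣ) : A)) = ℓ a := by
      rw [← hL, ← hL, map_mul (Ideal.Quotient.mk k), map_mul (Ideal.Quotient.mk k), h1, h2,
        one_mul, mul_one]
    rw [hN, hN, h3]
    refine Ideal.Quotient.eq.1 ?_
    rw [map_mul, map_mul, h1, h2, one_mul, mul_one]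

lemma isUnit_iota (p : GK k) : IsUnit (iota k p) := by
  induction p using Quotient.inductionOn with
  | h g => exact g.isUnit.map (Ideal.Quotient.mk k)

variable {k} in
lemma iota_mul_mk_ne_zero {n : A} (hn : n ∉ k) (p : GK k) :
    iota k p * Ideal.Quotient.mk k n ≠ 0 := by
  rw [Ne, (isUnit_iota k p).mul_right_eq_zero]
  exact fun h => hn (Ideal.Quotient.eq_zero_iff_mem.1 h)

lemma iota_smul (g : Aˣ) (p : GK k) :
    iota k (g • p) = Ideal.Quotient.mk k (g : A) * iota k p := by
  induction p using Quotient.inductionOn with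
  | h h => rfl

lemma iota_basePoint : iota k (basePoint k) = 1 := rfl

lemma exists_smul_basePoint (p : GK k) : ∃ g : Aˣ, g • basePoint k = p := by
  induction p using Quotient.inductionOn with
  | h g => exact ⟨g, congrArg (proj k) (mul_one g)⟩

variable [IsClosed (k : Set A)]

/-- The quotient norm makes `A/k` a normed ring. -/
noncomputable abbrev quotientNormedRing : NormedRing (A ⧸ k) :=
  { Submodule.Quotient.normedAddCommGroup k, Ideal.Quotient.ring k with
    norm_mul_le := fun x y => by
      -- Lift `x` and `y` to elements of norm below `‖x‖ + δ` and `‖y‖ + δ`, with `δ` so small that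
      -- the product of these bounds is less than `‖x‖ * ‖y‖ + ε`.
      refine le_of_forall_pos_le_add fun ε hε => ?_
      have hc : Filter.Tendsto (fun δ : ℝ => (‖x‖ + δ) * (‖y‖ + δ)) (nhdsWithin 0 (Set.Ioi 0))
          (nhds (‖x‖ * ‖y‖)) := by
        have : Continuous fun δ : ℝ => (‖x‖ + δ) * (‖y‖ + δ) := by fun_prop
        simpa using (this.tendsto 0).mono_left nhdsWithin_le_nhds
      obtain ⟨δ, h, hδ⟩ := ((hc.eventually (gt_mem_nhds (lt_add_of_pos_right _ hε))).and
        self_mem_nhdsWithin).exists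
      obtain ⟨a, rfl, ha⟩ := Submodule.Quotient.norm_mk_lt x hδ
      obtain ⟨b, rfl, hb⟩ := Submodule.Quotient.norm_mk_lt y hδ
      calc ‖(Submodule.Quotient.mk (a * b) : A ⧸ k)‖ ≤ ‖a * b‖ :=
            Submodule.Quotient.norm_mk_le k _
        _ ≤ ‖a‖ * ‖b‖ := norm_mul_le a b
        _ ≤ _ := (mul_le_mul ha.le hb.le (norm_nonneg _) (by positivity)).trans h.le }

attribute [local instance] quotientNormedRing

/-- `A/k` is a complex normed algebra. -/
noncomputable abbrev quotientNormedAlgebra : NormedAlgebra ℂ (A ⧸ k) :=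
  { (Ideal.Quotient.algebra ℂ : Algebra ℂ (A ⧸ k)) with
    norm_smul_le := (Submodule.Quotient.normedSpace k ℂ).norm_smul_le }

attribute [local instance] quotientNormedAlgebra

/-- As `k` is proper, the class of `1` in the normed space `A/k` is nonzero; Hahn–Banach gives a
functional there with value `1` on it, which is pulled back to `A`. -/
lemma exists_isHahnBanachExtension (hk : k ≠ ⊤) : ∃ ℓ : A →L[ℂ] ℂ, IsHahnBanachExtension k ℓ := by
  have h1 : (Ideal.Quotient.mk k 1 : A ⧸ k) ≠ 0 := fun h =>
    hk ((Ideal.eq_top_iff_one k).2 (Ideal.Quotient.eq_zero_iff_mem.1 h))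
  obtain ⟨f, hf⟩ := SeparatingDual.exists_eq_one (R := ℂ) h1
  let q : A →L[ℂ] A ⧸ k := ⟨k.mkQ.restrictScalars ℂ, (isOpenMap_continuous_quotient k).2⟩
  refine ⟨f.comp q, fun x hx => ?_, hf⟩
  have : (Ideal.Quotient.mk k x : A ⧸ k) = 0 := Ideal.Quotient.eq_zero_iff_mem.2 hx
  show f (Ideal.Quotient.mk k x) = 0
  rw [this, map_zero]

/-- In the chart the action is a bounded linear map, hence its own derivative. -/
lemma actDiff_apply (g : Aˣ) (p : GK k) (u : A ⧸ k) :
    actDiff k g p u = Ideal.Quotient.mk k (g : A) * u := by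
  have h : HasFDerivAt (fun b : A ⧸ k => Ideal.Quotient.mk k (g : A) * b)
      (ContinuousLinearMap.mul ℝ (A ⧸ k) (Ideal.Quotient.mk k (g : A))) (iota k p) :=
    (ContinuousLinearMap.mul ℝ (A ⧸ k) (Ideal.Quotient.mk k (g : A))).hasFDerivAt
  exact congrArg (fun T : (A ⧸ k) →L[ℝ] A ⧸ k => T u)
    (hasMFDerivAt_of_iota k (iota_smul k g) h).mfderiv

/-- The bundle map induced by `a ↦ ℓ(a) n` is given in the global chart by translates of the rank
one operator of `A/k`. -/
lemma isInducedBy_rankOne_iff {ℓ : A →L[ℂ] ℂ} {L : (A ⧸ k) →L[ℂ] ℂ}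
    (hL : ∀ a, L (Ideal.Quotient.mk k a) = ℓ a) (n : A) (𝒩 : BundleMap (E := A ⧸ k) (GK k)) :
    IsInducedBy k (rankOne ℓ n) 𝒩 ↔
      ∀ p (u : A ⧸ k), 𝒩 p u = translateRankOne L (Ideal.Quotient.mk k n) (iota k p) u := by
  have unit (g : Aˣ) : IsUnit (Ideal.Quotient.mk k (g : A)) := g.isUnit.map _
  have hbase (v : A) : translateRankOne L (Ideal.Quotient.mk k n) (iota k (basePoint k))
      (Ideal.Quotient.mk k v) = Ideal.Quotient.mk k (rankOne ℓ n v) := by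
    rw [translateRankOne_apply, iota_basePoint, Ring.inverse_one, one_mul, one_mul, hL]
    rfl
  have htrans (g : Aˣ) (u : A ⧸ k) :
      translateRankOne L (Ideal.Quotient.mk k n) (iota k (g • basePoint k))
          (Ideal.Quotient.mk k (g : A) * u) =
        Ideal.Quotient.mk k (g : A) *
          translateRankOne L (Ideal.Quotient.mk k n) (iota k (basePoint k)) u := by
    rw [iota_smul]
    exact translateRankOne_mul L _ _ _ u (unit g) (isUnit_iota k _)
  constructor
  · intro h p u
    obtain ⟨g, rfl⟩ := exists_smul_basePoint k p
    -- Every tangent vector at `g·p₀` is the translate by `g` of the class of some `v`, so the two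
    -- conditions determine `𝒩`.
    obtain ⟨v, hv⟩ := Ideal.Quotient.mk_surjective (Ring.inverse (Ideal.Quotient.mk k (g : A)) * u)
    have hu : u = Ideal.Quotient.mk k (g : A) * Ideal.Quotient.mk k v := by
      rw [hv, Ring.mul_inverse_cancel_left _ _ (unit g)]
    have h1 : 𝒩 (basePoint k) (Ideal.Quotient.mk k v) = Ideal.Quotient.mk k (rankOne ℓ n v) := by
      have := h.base v
      rwa [projDiff_apply, projDiff_apply] at this
    have h2 := h.translate g (Ideal.Quotient.mk k v)
    rw [actDiff_apply] at h2
    rw [hu, htrans, hbase]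
    refine h2.trans ?_
    rw [h1]
    exact actDiff_apply k g _ _
  · intro h
    refine ⟨fun v => ?_, fun g u => ?_⟩
    · rw [projDiff_apply, projDiff_apply]
      exact (h _ _).trans (hbase v)
    · refine (congrArg (𝒩 _) (actDiff_apply k g _ u)).trans ((h _ _).trans ((htrans g u).trans ?_))
      rw [← h (basePoint k) u]
      exact (actDiff_apply k g _ _).symm

end QuotientAlgebra


/-! ### Kernel, torsion and the Nijenhuis criterion -/

section RankOneBundleMap

variable {A : Type*} [CStarAlgebra A] {k : Ideal A} [k.IsTwoSided] [IsClosed (k : Set A)]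

attribute [local instance] quotientNormedRing quotientNormedAlgebra

variable {ℓ : A →L[ℂ] ℂ} {n : A} {𝒩 : BundleMap (E := A ⧸ k) (GK k)}

lemma existsUnique_isInducedBy_rankOne (hℓ : IsHahnBanachExtension k ℓ) (n : A) :
    ∃! 𝒩 : BundleMap (E := A ⧸ k) (GK k), IsInducedBy k (rankOne ℓ n) 𝒩 := by
  obtain ⟨L, hL⟩ := exists_quotientFunctional k hℓ
  simp only [isInducedBy_rankOne_iff k hL]
  refine ⟨fun p => translateRankOne L (Ideal.Quotient.mk k n) (iota k p), fun p u => rfl, ?_⟩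
  intro 𝒩 h
  funext p
  exact ContinuousLinearMap.ext (h p)

lemma IsInducedBy.isHomogeneous_rankOne (hℓ : IsHahnBanachExtension k ℓ)
    (h : IsInducedBy k (rankOne ℓ n) 𝒩) : IsHomogeneous k 𝒩 := by
  obtain ⟨L, hL⟩ := exists_quotientFunctional k hℓ
  rw [isInducedBy_rankOne_iff k hL] at h
  refine ⟨isSmoothBundleMap_of_contDiffAt k
    (θ := fun x => translateRankOne L (Ideal.Quotient.mk k n) x.1 x.2) (fun p u => ?_) h, ?_⟩
  · obtain ⟨b, hb⟩ := isUnit_iota k p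
    rw [← hb]
    exact contDiffAt_translateRankOne L _ b u
  · intro g p u
    refine (actDiff_apply k g p _).trans ?_
    refine .trans ?_ (congrArg (𝒩 (g • p)) (actDiff_apply k g p u)).symm
    refine .trans ?_ (h _ _).symm
    rw [iota_smul]
    refine .trans ?_ (translateRankOne_mul L _ _ _ u (g.isUnit.map (Ideal.Quotient.mk k))
      (isUnit_iota k p)).symm
    exact congrArg (Ideal.Quotient.mk k (g : A) * ·) (h p u)

lemma IsInducedBy.exists_ker_rankOne (hℓ : IsHahnBanachExtension k ℓ) (hn : n ∉ k)
    (h : IsInducedBy k (rankOne ℓ n) 𝒩) (p : GK k) :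
    ∃ H : Submodule ℂ (A ⧸ k),
      (∀ u : A ⧸ k, u ∈ H ↔ 𝒩 p u = 0) ∧ Module.finrank ℂ ((A ⧸ k) ⧸ H) = 1 := by
  obtain ⟨L, hL⟩ := exists_quotientFunctional k hℓ
  rw [isInducedBy_rankOne_iff k hL] at h
  let f : (A ⧸ k) →ₗ[ℂ] ℂ :=
    (L.comp (ContinuousLinearMap.mul ℂ (A ⧸ k) (Ring.inverse (iota k p)))).toLinearMap
  have hf (u : A ⧸ k) : f u = L (Ring.inverse (iota k p) * u) := rfl
  refine ⟨LinearMap.ker f, fun u => ?_, ?_⟩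
  · rw [LinearMap.mem_ker, hf, show 𝒩 p u = _ from h p u, translateRankOne_apply]
    exact (smul_eq_zero_iff_left (iota_mul_mk_ne_zero hn p)).symm
  · have hsurj : Function.Surjective f := by
      refine LinearMap.surjective fun h0 => ?_
      -- The functional is nonzero since it takes the value `ℓ(1) = 1` at the point `ι(p)` itself.
      have h1 : f (iota k p) = 1 := by
        rw [hf, Ring.inverse_mul_cancel _ (isUnit_iota k p), ← map_one (Ideal.Quotient.mk k), hL,
          hℓ.map_one]
      rw [h0] at h1
      exact zero_ne_one h1
    rw [(f.quotKerEquivOfSurjective hsurj).finrank_eq, Module.finrank_self]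

/-- The translate to `p` of the class of `a - ℓ(a)1` lies in the kernel for every `a`. Injectivity
would put all these elements in `k`, so that `A = ℂ1 + k`. -/
lemma IsInducedBy.not_injective_rankOne (hℓ : IsHahnBanachExtension k ℓ)
    (h : IsInducedBy k (rankOne ℓ n) 𝒩)
    (hA : Submodule.span ℂ {(1 : A)} ⊔ k.restrictScalars ℂ ≠ ⊤) (p : GK k) :
    ¬ Function.Injective (𝒩 p) := by
  obtain ⟨L, hL⟩ := exists_quotientFunctional k hℓ
  rw [isInducedBy_rankOne_iff k hL] at h
  intro hinj
  refine hA (eq_top_iff.2 fun a _ => ?_)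
  have h1 : 𝒩 p (iota k p * Ideal.Quotient.mk k (a - ℓ a • 1)) = 𝒩 p 0 := by
    rw [map_zero]
    refine (h _ _).trans ?_
    rw [translateRankOne_apply, Ring.inverse_mul_cancel_left _ _ (isUnit_iota k p), hL, map_sub,
      map_smul, hℓ.map_one, smul_eq_mul, mul_one, sub_self, zero_smul]
    rfl
  have h2 : iota k p * Ideal.Quotient.mk k (a - ℓ a • 1) = 0 := hinj h1
  rw [(isUnit_iota k p).mul_right_eq_zero, Ideal.Quotient.eq_zero_iff_mem] at h2
  exact Submodule.mem_sup.2 ⟨ℓ a • 1, Submodule.smul_mem _ _ (Submodule.mem_span_singleton_self 1),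
    a - ℓ a • 1, h2, add_sub_cancel _ _⟩

lemma IsInducedBy.not_isAlmostComplex_rankOne (hℓ : IsHahnBanachExtension k ℓ)
    (h : IsInducedBy k (rankOne ℓ n) 𝒩)
    (hA : Submodule.span ℂ {(1 : A)} ⊔ k.restrictScalars ℂ ≠ ⊤) : ¬ IsAlmostComplex 𝒩 := by
  rintro ⟨-, hJ⟩
  refine h.not_injective_rankOne hℓ hA (basePoint k) fun u v huv => ?_
  rw [← neg_inj, ← hJ, ← hJ, huv]

/-- The torsion of the bundle map induced by `a ↦ ℓ(a) n`, in left-trivialized form. -/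
lemma nijenhuisTorsion_rankOne {L : (A ⧸ k) →L[ℂ] ℂ}
    (h : ∀ p (u : A ⧸ k), 𝒩 p u = translateRankOne L (Ideal.Quotient.mk k n) (iota k p) u)
    (h𝒩 : IsSmoothBundleMap 𝒩) {X Y : GK k → A ⧸ k}
    (hX : IsSmoothVectorField (E := A ⧸ k) (M := GK k) X)
    (hY : IsSmoothVectorField (E := A ⧸ k) (M := GK k) Y) (p : GK k) {x y : A ⧸ k}
    (hx : X p = iota k p * x) (hy : Y p = iota k p * y) :
    nijenhuisTorsion 𝒩 X Y p =
      (L y * L ⁅x, Ideal.Quotient.mk k n⁆ - L x * L ⁅y, Ideal.Quotient.mk k n⁆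
        - L (Ideal.Quotient.mk k n) * L ⁅x, y⁆) • (iota k p * Ideal.Quotient.mk k n) := by
  have smooth {Z : GK k → A ⧸ k} (hZ : IsSmoothVectorField (E := A ⧸ k) (M := GK k) Z) :
      IsSmoothVectorField (E := A ⧸ k) (M := GK k) (fun q => 𝒩 q (Z q)) := h𝒩.comp hZ
  -- The formula for `𝒩` holds only on the range of `ι`; equality near `ι(p)` is enough, since
  -- brackets depend only on germs.
  have chart (Z : GK k → A ⧸ k) :
      (fun b => (fun q => 𝒩 q (Z q) : GK k → A ⧸ k) (Function.invFun (iota k) b))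
        =ᶠ[nhds (iota k p)] fun b =>
          translateRankOne L (Ideal.Quotient.mk k n) b (Z (Function.invFun (iota k) b)) := by
    filter_upwards [range_iota_mem_nhds k p]
    rintro _ ⟨q, rfl⟩
    refine (h _ _).trans ?_
    rw [invFun_iota]
  have cX := (isSmoothVectorField_iff k X).1 hX
  have cY := (isSmoothVectorField_iff k Y).1 hY
  have cX' := (isSmoothVectorField_iff k _).1 (smooth hX)
  have cY' := (isSmoothVectorField_iff k _).1 (smooth hY)
  have b1 := mlieBracket_eq_lieBracket k (cX' p) (cY p)
  have b2 := mlieBracket_eq_lieBracket k (cX p) (cY' p)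
  have b3 := mlieBracket_eq_lieBracket k (cX' p) (cY' p)
  have b4 := mlieBracket_eq_lieBracket k (cX p) (cY p)
  rw [(chart X).lieBracket_vectorField_eq .rfl] at b1
  rw [Filter.EventuallyEq.lieBracket_vectorField_eq .rfl (chart Y)] at b2
  rw [(chart X).lieBracket_vectorField_eq (chart Y)] at b3
  obtain ⟨b, hb⟩ := isUnit_iota k p
  have dX := (contDiffAt_comp_invFun_iota k (cX p)).differentiableAt (by simp)
  have dY := (contDiffAt_comp_invFun_iota k (cY p)).differentiableAt (by simp)
  rw [← hb] at dX dY
  have key := translateRankOne_torsion L (Ideal.Quotient.mk k n) b dX dY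
  rw [hb, invFun_iota, hx, hy, ← hb, Units.inv_mul_cancel_left, Units.inv_mul_cancel_left, hb]
    at key
  refine .trans ?_ key
  rw [← b1, ← b2, ← b3, ← b4]
  refine congrArg₂ (α := A ⧸ k) (· - ·) (congrArg₂ (α := A ⧸ k) (· - ·)
    (congrArg₂ (α := A ⧸ k) (· + ·) (h p _) (h p _)) rfl) ?_
  exact (congrArg (𝒩 p) (h p _)).trans (h p _)

lemma IsInducedBy.isNijenhuis_rankOne_iff (hℓ : IsHahnBanachExtension k ℓ) (hn : n ∉ k)
    (h : IsInducedBy k (rankOne ℓ n) 𝒩) :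
    IsNijenhuis 𝒩 ↔ ∀ v w : A, ℓ w * ℓ ⁅v, n⁆ - ℓ v * ℓ ⁅w, n⁆ - ℓ n * ℓ ⁅v, w⁆ = 0 := by
  have h𝒩 := (h.isHomogeneous_rankOne hℓ).1
  obtain ⟨L, hL⟩ := exists_quotientFunctional k hℓ
  rw [isInducedBy_rankOne_iff k hL] at h
  have hbr (v w : A) : L ⁅Ideal.Quotient.mk k v, Ideal.Quotient.mk k w⁆ = ℓ ⁅v, w⁆ := by
    rw [← hL, Ring.lie_def, Ring.lie_def, map_sub (Ideal.Quotient.mk k),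
      map_mul (Ideal.Quotient.mk k), map_mul (Ideal.Quotient.mk k)]
  constructor
  · rintro ⟨-, hT⟩ v w
    -- Fields constant in the chart suffice for this direction: `ι(p₀) = 1`, so at the base point
    -- they equal their left trivializations.
    have hc (u : A ⧸ k) : IsSmoothVectorField (E := A ⧸ k) (M := GK k) (fun _ => u) :=
      (isSmoothVectorField_iff k _).2 contMDiff_const
    have key := nijenhuisTorsion_rankOne h h𝒩 (hc (Ideal.Quotient.mk k v))
      (hc (Ideal.Quotient.mk k w)) (basePoint k) (one_mul _).symm (one_mul _).symm
    have key' := key.symm.trans (hT _ _ (hc _) (hc _) _)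
    have := (smul_eq_zero_iff_left (iota_mul_mk_ne_zero hn (basePoint k))).1 key'
    simpa only [hbr, hL] using this
  · refine fun hvw => ⟨h𝒩, fun X Y hX hY p => ?_⟩
    have lift (u : A ⧸ k) : ∃ v : A, u = iota k p * Ideal.Quotient.mk k v := by
      obtain ⟨v, hv⟩ := Ideal.Quotient.mk_surjective (Ring.inverse (iota k p) * u)
      exact ⟨v, by rw [hv, Ring.mul_inverse_cancel_left _ _ (isUnit_iota k p)]⟩
    obtain ⟨v, hv⟩ := lift (X p)
    obtain ⟨w, hw⟩ := lift (Y p)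
    refine (nijenhuisTorsion_rankOne h h𝒩 hX hY p hv hw).trans ?_
    rw [hbr, hbr, hbr, hL, hL, hL, hvw, zero_smul]
    rfl

end RankOneBundleMap

end RankOne

theorem mainTheorem5 {A : Type*} [CStarAlgebra A] (k : Ideal A) [k.IsTwoSided]
    [IsClosed (k : Set A)] (hk : k ≠ ⊤) :
    (∃ ℓ : A →L[ℂ] ℂ, RankOne.IsHahnBanachExtension k ℓ) ∧
    ∀ ℓ : A →L[ℂ] ℂ, RankOne.IsHahnBanachExtension k ℓ → ∀ n : A, n ∉ k →
      RankOne.IsAdmissible k (RankOne.rankOne ℓ n) ∧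
      (∃! 𝒩 : RankOne.BundleMap (E := A ⧸ k) (RankOne.GK k),
        RankOne.IsInducedBy k (RankOne.rankOne ℓ n) 𝒩) ∧
      ∀ 𝒩 : RankOne.BundleMap (E := A ⧸ k) (RankOne.GK k),
        RankOne.IsInducedBy k (RankOne.rankOne ℓ n) 𝒩 →
          RankOne.IsHomogeneous k 𝒩 ∧
          (∀ p : RankOne.GK k, ∃ H : Submodule ℂ (A ⧸ k),
            (∀ u : A ⧸ k, u ∈ H ↔ 𝒩 p u = 0) ∧ Module.finrank ℂ ((A ⧸ k) ⧸ H) = 1) ∧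
          (Submodule.span ℂ {(1 : A)} ⊔ k.restrictScalars ℂ ≠ ⊤ →
            (∀ p : RankOne.GK k, ¬ Function.Bijective (𝒩 p)) ∧
            ¬ RankOne.IsAlmostComplex 𝒩) ∧
          (ℓ n ≠ 0 → (RankOne.IsNijenhuis 𝒩 ↔ ∀ v w : A, ℓ ⁅v, w⁆ = 0)) ∧
          (ℓ n = 0 → (RankOne.IsNijenhuis 𝒩 ↔ ∀ v : A, ℓ ⁅v, n⁆ = 0)) := by
  refine ⟨RankOne.exists_isHahnBanachExtension k hk, fun ℓ hℓ n hn => ⟨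
    RankOne.isAdmissible_rankOne k hℓ n, RankOne.existsUnique_isInducedBy_rankOne hℓ n,
    fun 𝒩 h => ⟨h.isHomogeneous_rankOne hℓ, h.exists_ker_rankOne hℓ hn, fun hA =>
      ⟨fun p hp => h.not_injective_rankOne hℓ hA p hp.1, h.not_isAlmostComplex_rankOne hℓ hA⟩,
      fun hn0 => ?_, fun hn0 => ?_⟩⟩⟩
  all_goals rw [h.isNijenhuis_rankOne_iff hℓ hn]
  · constructor
    · intro H
      -- Put `w = 1`: `ℓ(1) = 1` and commutators with `1` vanish, leaving only `ℓ[v,n]`.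
      have H1 (v : A) : ℓ ⁅v, n⁆ = 0 := by
        simpa [hℓ.map_one, Ring.lie_def] using H v 1
      intro v w
      simpa [H1, hn0] using H v w
    · intro H v w
      simp only [H, mul_zero, sub_zero]
  · constructor
    · intro H v
      simpa [hℓ.map_one, hn0, Ring.lie_def] using H v 1
    · intro H v w
      simp only [H, hn0, mul_zero, zero_mul, sub_zero]
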